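/- Let $(\mathcal N,\mathcal E,s,t)$ be a finite directed acyclic graph, parallel edges allowed, in which the source $s$ is the unique node without incoming edges and the sink $t$ is the unique node without outgoing edges. A path is a nonempty sequence of consecutive edges leading from $s$ to $t$; let $\mathcal P$ be the set of all paths. Let $P_1,\dots,P_K$ be a finite sequence of paths, repetition allowed. For a node $n$ let $\Pi_n\subseteq\{1,\dots,K\}$ be the set of indices $k$ such that $P_k$ passes through $n$. A rearrangement of $P_1,\dots,P_K$ is a choice of a permutation $\sigma_n$ of $\Pi_n$ for every node $n$. It defines a new sequence of paths $P_1',\dots,P_K'$ as follows: $P_k'$ visits nodes $n_0=s,n_1,\dots,n_M=t$, and for $0\le i\le M-1$ it leaves $n_i$ along the edge by which the path $P_{k_i}$ leaves $n_i$, where $k_0=\sigma_{n_0}^{-1}(k)$ and $k_i=\sigma_{n_i}^{-1}(k_{i-1})$ for $i\ge 1$. Two sequences of paths are rearrangement equivalent if each is obtained from the other by a rearrangement. Two finite sequences are called distinct if neither is a reordering of the other (equivalently, if some element occurs a different number of times in them). (a) For every $\mathcal P'\subseteq\mathcal P$, the family of edge-indicator vectors $\big(\mathbf 1_{\{e\in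 P\}}\big)_{e\in\mathcal E}\in\mathbb R^{\mathcal E}$, $P\in\mathcal P'$, is linearly independent if and only if there are no two distinct, rearrangement-equivalent finite sequences of paths with all terms in $\mathcal P'$. (b) Let $X$ be a nonempty finite set. Identify each preference (linear order) $\succ$ on $X$ with the string of the elements of $X$ in descending order, and let its choice function be the vector in $\mathbb R^{X\times 2^X}$ whose entry at $(x,A)$ is $1$ if $x\in A$ and $x$ is the $\succ$-best element of $A$, and $0$ otherwise. Two sequences of preferences $\succ_1,\dots,\succ_K$ and $\succ_1',\dots,\succ_K'$ are rearrangement equivalent if there are permutations $\sigma_1,\dots,\sigma_{|X|}$ of $\{1,\dots,K\}$ such that, for all $k$ and $n$, the preferences $\succ_{\sigma_k(n)}$ and $\succ_n$ have the same set of $k-1$ best alternatives, and the $k$-th best alternative of $\succ_n'$ is the $k$-th best alternative of the preference $\succ_m$ with $m=(\sigma_1\circ\cdots\circ\sigma_k)^{-1}(n)$. Then, for every set $\mathcal S$ of preferences on $X$, the choice functions of the elements of $\mathcal S$ are linearly independent if and only if there are no two distinct, rearrangement-equivalent finite sequences of preferences with all terms in $\mathcal S$. -/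

import Mathlib

/-- A directed acyclic (multi)graph with nodes `N` and edges `E`, where `e : E` is directed from
`tail e` to `head e`. Distinct edges may join the same pair of nodes. The source `s` is the only
node without incoming edges and the sink `t` is the only node without outgoing edges. -/
structure SourceSinkDAG (N E : Type*) where
  tail : E → N
  head : E → N
  s : N
  t : N
  /-- No node can be reached from itself along one or more edges. -/
  acyclic : ∀ n : N, ¬ Relation.TransGen (fun a b : N => ∃ e : E, tail e = a ∧ head e = b) n n
  source_iff : ∀ n : N, (∀ e : E, head e ≠ n) ↔ n = s
  sink_iff : ∀ n : N, (∀ e : E, tail e ≠ n) ↔ n = t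

namespace SourceSinkDAG

variable {N E : Type*} (G : SourceSinkDAG N E)

/-- A path from the source to the sink: a nonempty list of consecutive edges. -/
@[ext]
structure Path where
  edges : List E
  ne_nil : edges ≠ []
  chain : edges.IsChain (fun e e' => G.head e = G.tail e')
  starts : G.tail (edges.head ne_nil) = G.s
  ends : G.head (edges.getLast ne_nil) = G.t

variable {G}

open Classical in
/-- The edge-indicator vector of a path (the unit flow along it). -/
noncomputable def Path.indicator (P : G.Path) : E → ℝ :=
  fun e => if e ∈ P.edges then 1 else 0

/-- `P` passes through `n` if `n` is an endpoint of some edge of `P`. -/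
def Path.PassesThrough (P : G.Path) (n : N) : Prop :=
  ∃ e ∈ P.edges, G.tail e = n ∨ G.head e = n

/-- The (indices of the) paths of the sequence `P` that pass through `n`. -/
def indicesAt {K : ℕ} (P : Fin K → G.Path) (n : N) : Set (Fin K) :=
  {k | (P k).PassesThrough n}

/-- A rearrangement of `P`: for each node, a permutation of the indices of the paths through it. -/
abbrev Rearrangement {K : ℕ} (P : Fin K → G.Path) : Type _ :=
  ∀ n : N, Equiv.Perm (indicesAt P n)

/-- `Follows P σ k l`: the list of edges `l` is traced out by a walker that carries a path index,
initially `k`. On reaching a node `n` with index `i`, the walker replaces `i` by `σ_n⁻¹(i)` and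
leaves `n` along the edge of the path with the new index. -/
def Follows {K : ℕ} (P : Fin K → G.Path) (σ : Rearrangement P) : Fin K → List E → Prop
  | _, [] => True
  | k, e :: l => ∃ h : k ∈ indicesAt P (G.tail e),
      e ∈ (P ((σ (G.tail e)).symm ⟨k, h⟩)).edges ∧
        Follows P σ ((σ (G.tail e)).symm ⟨k, h⟩) l

/-- `P'` is the sequence of paths that some rearrangement of `P` defines: the `k`-th path of `P'`
is traced out from the source by a walker whose initial index is `k`. -/
def IsRearrangementOf {K : ℕ} (P' P : Fin K → G.Path) : Prop :=
  ∃ σ : Rearrangement P, ∀ k, Follows P σ k (P' k).edges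

/-- Two sequences of paths are rearrangement equivalent if each is obtained from the other by a
rearrangement. -/
def RearrangementEquivalent {K : ℕ} (P P' : Fin K → G.Path) : Prop :=
  IsRearrangementOf P' P ∧ IsRearrangementOf P P'

end SourceSinkDAG

/-- Two finite sequences are distinct if neither is a reordering of the other, that is, if some
element occurs a different number of times in them. -/
def DistinctSequences {α : Type*} {K : ℕ} (p p' : Fin K → α) : Prop :=
  ¬ ∃ π : Equiv.Perm (Fin K), p' = p ∘ π

/-- A preference (linear order) on the finite set `X`, written as the string of the alternatives in
descending order: `p k` is the `(k+1)`-st most preferred alternative, and `x` is preferred to `y`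
if `p.symm x < p.symm y`. -/
abbrev Preference (X : Type*) [Fintype X] : Type _ := Fin (Fintype.card X) ≃ X

namespace Preference

variable {X : Type*} [Fintype X]

open Classical in
/-- The choice function of a preference as a 0-1 vector: the entry at `(x, A)` is one if and only
if `x` is the best alternative of the menu `A`. -/
noncomputable def choiceVector (p : Preference X) : X × Finset X → ℝ :=
  fun c => if c.1 ∈ c.2 ∧ ∀ y ∈ c.2, p.symm c.1 ≤ p.symm y then 1 else 0

/-- Two preferences are `k`-compatible if they have the same set of `k` best alternatives. -/
def Compatible (k : ℕ) (p q : Preference X) : Prop :=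
  {x : X | (p.symm x : ℕ) < k} = {x : X | (q.symm x : ℕ) < k}

/-- The composition `σ 0 ∘ σ 1 ∘ ⋯ ∘ σ k`. -/
def braid {K : ℕ} (σ : ℕ → Equiv.Perm (Fin K)) : ℕ → Equiv.Perm (Fin K)
  | 0 => σ 0
  | k + 1 => braid σ k * σ (k + 1)

/-- `p` and `p'` are rearrangement equivalent if there are permutations `σ_k` of the indices,
one for each rank `k`, such that `σ_k` only exchanges preferences of `p` with the same
set of better-ranked alternatives, and the rank-`k` alternative of the `n`-th preference of `p'`
is that of the preference of `p` with index `(σ_0 ∘ ⋯ ∘ σ_k)⁻¹(n)`. Ranks start at `0`. -/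
def RearrangementEquivalent {K : ℕ} (p p' : Fin K → Preference X) : Prop :=
  ∃ σ : ℕ → Equiv.Perm (Fin K),
    (∀ k < Fintype.card X, ∀ n, Compatible k (p (σ k n)) (p n)) ∧
      ∀ n (k : Fin (Fintype.card X)), p' n k = p ((braid σ k).symm n) k

end Preference

/-! Both parts reduce to one fact: rearrangement equivalence of two sequences means that their 0-1
vectors have the same sum. Linear algebra (`linearIndependent_zero_one_iff`): a real relation among
0-1 vectors yields a rational one, hence an integral one, and its positive and negative parts are
two multisets with equal sums. They have the same size because each vector sums to one over a fixed
set of coordinates: the edges leaving the source, or the entries of the full menu. Paths: a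
rearrangement injects the uses of an edge in the new sequence into its uses in the old one, so
mutual rearrangements give equal edge counts. Conversely, equal counts allow the users of each edge
to be matched, and the matchings on the edges into and out of a node determine its permutation
(`exists_perm_at_node`). Preferences: a preference is a maximal chain of subsets of `X`, and
equivalence amounts to equal counts on every step from `B` to `B ∪ {x}`. Inclusion-exclusion over
subsets translates these counts into sums of choice functions. -/

/-- Two families on a finite type with the same fibre sizes differ by a permutation. -/
theorem exists_perm_of_card_fiber_eq {κ α : Type*} [Fintype κ] [DecidableEq α] (f g : κ → α)
    (h : ∀ a, (Finset.univ.filter fun k => f k = a).card =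
      (Finset.univ.filter fun k => g k = a).card) :
    ∃ π : Equiv.Perm κ, ∀ k, g k = f (π k) := by
  have e : ∀ a, Nonempty ({k // g k = a} ≃ {k // f k = a}) := fun a =>
    ⟨Fintype.equivOfCardEq (by rw [Fintype.card_subtype, Fintype.card_subtype, h a])⟩
  have e := fun a => (e a).some
  refine ⟨(Equiv.sigmaFiberEquiv g).symm.trans
    ((Equiv.sigmaCongrRight e).trans (Equiv.sigmaFiberEquiv f)), fun k => ?_⟩
  exact (e (g k) ⟨k, rfl⟩).2.symm

/-- Two injections into a finite type differ by a permutation. -/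
theorem exists_perm_comp_eq {α β : Type*} [Finite β] (f g : α → β) (hf : f.Injective)
    (hg : g.Injective) : ∃ π : Equiv.Perm β, ∀ a, π (f a) = g a := by
  classical
  cases nonempty_fintype β
  let e : {x // x ∈ Set.range f} ≃ {x // x ∈ Set.range g} :=
    (Equiv.ofInjective f hf).symm.trans (Equiv.ofInjective g hg)
  refine ⟨e.extendSubtype, fun a => ?_⟩
  rw [e.extendSubtype_apply_of_mem (f a) ⟨a, rfl⟩]
  change (Equiv.ofInjective g hg
    ((Equiv.ofInjective f hf).symm (Equiv.ofInjective f hf a)) : β) = g a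
  rw [Equiv.symm_apply_apply]
  rfl

/-! ### Linear relations between 0-1 vectors -/

theorem Multiset.exists_map_univ_eq {α : Type*} (M : Multiset α) {K : ℕ} (hK : M.card = K) :
    ∃ p : Fin K → α, Finset.univ.val.map p = M := by
  obtain ⟨l, rfl⟩ : ∃ l : List α, (l : Multiset α) = M := Quot.exists_rep M
  obtain rfl : l.length = K := hK
  exact ⟨l.get, (Fin.univ_val_map _).trans (congrArg _ (List.ofFn_get l))⟩

theorem DistinctSequences.exists_card_ne {α : Type*} [DecidableEq α] {K : ℕ} {p p' : Fin K → α}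
    (h : DistinctSequences p p') : ∃ a, (Finset.univ.filter fun k => p k = a).card ≠
      (Finset.univ.filter fun k => p' k = a).card := by
  by_contra! hc
  obtain ⟨π, hπ⟩ := exists_perm_of_card_fiber_eq p p' hc
  exact h ⟨π, funext hπ⟩

-- Each element is counted by exactly one `b ∈ B`, so the coordinate sums determine the length of a
-- sequence.
open Classical in
theorem Multiset.card_eq_sum_countP {ι β : Type*} (r : ι → β → Prop) (B : Finset β)
    (hB : ∀ i, (B.filter fun b => r i b).card = 1) (M : Multiset ι) :
    M.card = ∑ b ∈ B, M.countP (fun i => r i b) := by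
  induction M using Multiset.induction_on with
  | empty => simp
  | cons a M ih =>
    simp only [Multiset.card_cons, Multiset.countP_cons, Finset.sum_add_distrib, ← ih]
    rw [← Finset.card_filter, hB]

open Classical in
/-- An integral linear relation between zero-one vectors splits into a pair of sequences with
equal coordinate sums. -/
theorem exists_distinctSequences_of_int_relation {ι β : Type*} (r : ι → β → Prop) (B : Finset β)
    (hB : ∀ i, (B.filter fun b => r i b).card = 1) (s : Finset ι) (z : ι → ℤ)
    (hz : ∀ b, ∑ i ∈ s, z i * (if r i b then 1 else 0) = 0) {j : ι} (hj : j ∈ s) (hzj : z j ≠ 0) :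
    ∃ (K : ℕ) (p p' : Fin K → ι), DistinctSequences p p' ∧
      ∀ b, (Finset.univ.filter fun k => r (p k) b).card =
        (Finset.univ.filter fun k => r (p' k) b).card := by
  -- `toNat` truncates negative values to zero, so `M z` and `M (-z)` are the positive and negative
  -- parts of the relation.
  let M : (ι → ℤ) → Multiset ι := fun w => ∑ i ∈ s, Multiset.replicate (w i).toNat i
  have hcount : ∀ w (q : ι → Prop),
      (M w).countP q = ∑ i ∈ s, (w i).toNat * (if q i then 1 else 0) := by
    intro w q
    have : (M w).countP q = Multiset.countPAddMonoidHom q (M w) := rfl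
    rw [this, map_sum]
    refine Finset.sum_congr rfl fun i _ => ?_
    by_cases h : q i
    · simp only [Multiset.coe_countPAddMonoidHom, h, if_true, mul_one]
      rw [Multiset.countP_eq_card.2, Multiset.card_replicate]
      intro a ha
      rwa [Multiset.eq_of_mem_replicate ha]
    · simp only [Multiset.coe_countPAddMonoidHom, h, if_false, mul_zero]
      rw [Multiset.countP_eq_zero]
      intro a ha
      rwa [Multiset.eq_of_mem_replicate ha]
  have hdiff : ∀ q : ι → Prop, (((M z).countP q : ℕ) : ℤ) - ((M (-z)).countP q : ℕ) =
      ∑ i ∈ s, z i * (if q i then 1 else 0) := by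
    intro q
    rw [hcount, hcount]
    push_cast
    rw [← Finset.sum_sub_distrib]
    refine Finset.sum_congr rfl fun i _ => ?_
    rw [← sub_mul, Pi.neg_apply]
    congr 1
    omega
  have heq : ∀ b, (M z).countP (fun i => r i b) = (M (-z)).countP (fun i => r i b) := by
    intro b
    have := hdiff (fun i => r i b)
    rw [hz b] at this
    omega
  have hcard : (M (-z)).card = (M z).card := by
    rw [Multiset.card_eq_sum_countP r B hB, Multiset.card_eq_sum_countP r B hB]
    exact Finset.sum_congr rfl fun b _ => (heq b).symm
  obtain ⟨p, hp⟩ := (M z).exists_map_univ_eq rfl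
  obtain ⟨p', hp'⟩ := (M (-z)).exists_map_univ_eq hcard
  refine ⟨_, p, p', ?_, fun b => ?_⟩
  -- A reordering would make the two multisets equal, but their multiplicities at `j` differ by `z j
  -- ≠ 0`.
  · rintro ⟨π, rfl⟩
    have h : Finset.univ.val.map (p ∘ π) = Finset.univ.val.map p := by
      rw [← Multiset.map_map, Finset.univ.val.map_congr rfl (fun x _ => rfl)]
      congr 1
      exact congrArg Finset.val (Finset.map_univ_equiv π)
    rw [hp, hp'] at h
    have h2 := hdiff (fun i => i = j)
    rw [h, sub_self] at h2
    simp [hj] at h2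
    exact hzj h2.symm
  · have := heq b
    rw [← hp, ← hp', Multiset.countP_map, Multiset.countP_map] at this
    exact this

open Classical in
/-- Zero-one vectors whose coordinates over `B` sum to one are linearly independent if and only if
different multisets of them have different sums. -/
theorem linearIndependent_zero_one_iff {ι β : Type*} (r : ι → β → Prop) (B : Finset β)
    (hB : ∀ i, (B.filter fun b => r i b).card = 1) :
    LinearIndependent ℝ (fun i b => if r i b then (1 : ℝ) else 0) ↔
      ¬ ∃ (K : ℕ) (p p' : Fin K → ι), DistinctSequences p p' ∧
        ∀ b, (Finset.univ.filter fun k => r (p k) b).card =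
          (Finset.univ.filter fun k => r (p' k) b).card := by
  constructor
  · rintro h ⟨K, p, p', hd, he⟩
    obtain ⟨a, ha⟩ := hd.exists_card_ne
    have key : (∑ k, Finsupp.single (p k) (1 : ℝ)) = ∑ k, Finsupp.single (p' k) (1 : ℝ) := by
      apply h
      simp only [map_sum, Finsupp.linearCombination_single, one_smul]
      ext b
      simp only [Finset.sum_apply, Finset.sum_boole, he b]
    have := DFunLike.congr_fun key a
    simp only [Finsupp.finsetSum_apply, Finsupp.single_apply, Finset.sum_boole] at this
    exact ha (by exact_mod_cast this)
  · intro h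
    by_contra hl
    obtain ⟨s, g, hg, j, hj, hgj⟩ := not_linearIndependent_iff.1 hl
    apply h
    -- The vectors have rational entries, so a `ℚ`-linear functional on `ℝ` carries the real
    -- relation to a rational one; it is chosen not to kill the coefficient of `j`.
    obtain ⟨φ, hφ⟩ : ∃ φ : Module.Dual ℚ ℝ, φ (g j) ≠ 0 := by
      by_contra! hc
      exact hgj ((Module.forall_dual_apply_eq_zero_iff ℚ (g j)).1 hc)
    obtain ⟨m, hm⟩ := IsLocalization.exist_integer_multiples (nonZeroDivisors ℤ) s
      (fun i => φ (g i))
    have hm' : ∀ i, ∃ z : ℤ, i ∈ s → (z : ℚ) = (m : ℤ) * φ (g i) := by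
      intro i
      by_cases hi : i ∈ s
      · obtain ⟨z, hz⟩ := hm i hi
        exact ⟨z, fun _ => by simpa using hz⟩
      · exact ⟨0, fun h => absurd h hi⟩
    choose z hz using hm'
    refine exists_distinctSequences_of_int_relation r B hB s z (fun b => ?_) hj ?_
    · have h1 := congrFun hg b
      simp only [Finset.sum_apply, Pi.smul_apply, smul_eq_mul, Pi.zero_apply] at h1
      have h2 : ∑ i ∈ s, φ (g i) * (if r i b then 1 else 0) = 0 := by
        have h := congrArg φ h1
        rw [map_sum, map_zero] at h
        refine Eq.trans (Finset.sum_congr rfl fun i _ => ?_) h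
        split_ifs <;> simp
      have h3 : (((∑ i ∈ s, z i * (if r i b then 1 else 0) : ℤ)) : ℚ) = 0 := by
        have h := congrArg (((m : ℤ) : ℚ) * ·) h2
        simp only [mul_zero, Finset.mul_sum] at h
        push_cast
        refine Eq.trans (Finset.sum_congr rfl fun i hi => ?_) h
        rw [hz i hi, mul_assoc]
      exact_mod_cast h3
    · intro h0
      have := hz j hj
      rw [h0] at this
      have hmne : ((m : ℤ) : ℚ) ≠ 0 := by
        exact_mod_cast nonZeroDivisors.ne_zero m.2
      simp [hmne, hφ] at this

open Classical in
/-- The version of `linearIndependent_zero_one_iff` for a subfamily, with equality of sums expressed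
by an equivalent relation `Q`. -/
theorem linearIndependent_zero_one_subtype_iff {ι β : Type*} (r : ι → β → Prop) (B : Finset β)
    (hB : ∀ i, (B.filter fun b => r i b).card = 1)
    (Q : ∀ {K : ℕ}, (Fin K → ι) → (Fin K → ι) → Prop)
    (hQ : ∀ {K : ℕ} (p p' : Fin K → ι), Q p p' ↔
      ∀ b, (Finset.univ.filter fun k => r (p k) b).card =
        (Finset.univ.filter fun k => r (p' k) b).card) (S : Set ι) :
    LinearIndependent ℝ (fun (i : S) b => if r i b then (1 : ℝ) else 0) ↔
      ¬ ∃ (K : ℕ) (p p' : Fin K → ι), (∀ k, p k ∈ S) ∧ (∀ k, p' k ∈ S) ∧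
        DistinctSequences p p' ∧ Q p p' := by
  rw [linearIndependent_zero_one_iff (fun (i : S) b => r i b) B (fun i => hB i), not_iff_not]
  constructor
  · rintro ⟨K, p, p', hd, he⟩
    refine ⟨K, fun k => p k, fun k => p' k, fun k => (p k).2, fun k => (p' k).2, ?_, (hQ _ _).2 he⟩
    rintro ⟨π, hπ⟩
    exact hd ⟨π, funext fun k => Subtype.ext (congrFun hπ k)⟩
  · rintro ⟨K, p, p', hp, hp', hd, he⟩
    refine ⟨K, fun k => ⟨p k, hp k⟩, fun k => ⟨p' k, hp' k⟩, ?_, (hQ _ _).1 he⟩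
    rintro ⟨π, hπ⟩
    exact hd ⟨π, funext fun k => congrArg Subtype.val (congrFun hπ k)⟩

/-! ### Paths in a directed acyclic graph -/

namespace SourceSinkDAG

variable {N E : Type*} {G : SourceSinkDAG N E}

/-- One edge step between nodes. -/
def Step (G : SourceSinkDAG N E) (a b : N) : Prop := ∃ e : E, G.tail e = a ∧ G.head e = b

namespace Path

theorem pairwise_reachable (P : G.Path) :
    P.edges.Pairwise (fun e f => Relation.ReflTransGen G.Step (G.head e) (G.tail f)) := by
  have : IsTrans E (fun e f => Relation.ReflTransGen G.Step (G.head e) (G.tail f)) :=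
    ⟨fun _ f _ h₁ h₂ => (h₁.tail ⟨f, rfl, rfl⟩).trans h₂⟩
  rw [← List.isChain_iff_pairwise]
  exact P.chain.imp fun e f h => by rw [h]

/-- If two different edges of a path left the same node, the stretch of the path between them would
be a directed cycle. -/
theorem eq_of_tail_eq (P : G.Path) {e f : E} (he : e ∈ P.edges) (hf : f ∈ P.edges)
    (h : G.tail e = G.tail f) : e = f := by
  have : Std.Symm fun x y => G.tail x = G.tail y → x = y :=
    ⟨fun x y hxy hyx => (hxy hyx.symm).symm⟩
  refine List.Pairwise.forall_of_forall (R := fun x y => G.tail x = G.tail y → x = y)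
    (fun _ _ _ => rfl)
    (P.pairwise_reachable.imp fun {x y} hxy hx => ?_) he hf h
  exact absurd (Relation.TransGen.head' ⟨x, hx, rfl⟩ hxy) (G.acyclic _)

theorem eq_of_head_eq (P : G.Path) {e f : E} (he : e ∈ P.edges) (hf : f ∈ P.edges)
    (h : G.head e = G.head f) : e = f := by
  have : Std.Symm fun x y => G.head x = G.head y → x = y :=
    ⟨fun x y hxy hyx => (hxy hyx.symm).symm⟩
  refine List.Pairwise.forall_of_forall (R := fun x y => G.head x = G.head y → x = y)
    (fun _ _ _ => rfl)
    (P.pairwise_reachable.imp fun {x y} hxy hx => ?_) he hf h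
  exact absurd (Relation.TransGen.tail' hxy ⟨y, rfl, hx.symm⟩) (G.acyclic _)

theorem exists_tail_eq_source (P : G.Path) : ∃ e ∈ P.edges, G.tail e = G.s :=
  ⟨_, List.head_mem P.ne_nil, P.starts⟩

theorem head_eq_tail (P : G.Path) {l m : List E} {e f : E} (h : P.edges = l ++ e :: f :: m) :
    G.head e = G.tail f := by
  have := P.chain
  rw [h, List.isChain_append] at this
  exact this.2.1.rel

theorem exists_head_eq (P : G.Path) {f : E} (hf : f ∈ P.edges) (hs : G.tail f ≠ G.s) :
    ∃ e ∈ P.edges, G.head e = G.tail f := by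
  obtain ⟨l, l', hl⟩ := List.append_of_mem hf
  rcases List.eq_nil_or_concat' l with rfl | ⟨m, e, rfl⟩
  · refine absurd ?_ hs
    rw [← P.starts]
    simp [hl]
  · refine ⟨e, by simp [hl], ?_⟩
    exact P.head_eq_tail (l := m) (m := l') (by simp [hl])

end Path

theorem head_ne_source (e : E) : G.head e ≠ G.s := (G.source_iff G.s).2 rfl e

/-! ### Rearrangements cannot increase edge counts -/

section Track

variable {K : ℕ} (P : Fin K → G.Path) (σ : Rearrangement P)

open Classical in
/-- The change of index at the node `n`, extended to all indices. -/
noncomputable def indexStep (n : N) : Equiv.Perm (Fin K) := Equiv.Perm.ofSubtype (σ n).symm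

theorem indexStep_of_mem {n : N} {k : Fin K} (h : k ∈ indicesAt P n) :
    indexStep P σ n k = (σ n).symm ⟨k, h⟩ := by
  classical
  exact Equiv.Perm.ofSubtype_apply_of_mem _ h

/-- The index that a walker starting with index `k` carries after leaving along the edges `l`. -/
noncomputable def track (k : Fin K) (l : List E) : Fin K :=
  l.foldl (fun i e => indexStep P σ (G.tail e) i) k

theorem mem_edges_track : ∀ (l m : List E) (k : Fin K) (e : E),
    Follows P σ k (l ++ e :: m) → e ∈ (P (track P σ k (l ++ [e]))).edges := by
  intro l
  induction l with
  | nil =>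
    rintro m k e ⟨h, he, -⟩
    simpa [track, indexStep_of_mem P σ h] using he
  | cons f l ih =>
    rintro m k e ⟨h, -, hl⟩
    have := ih m _ e hl
    rwa [← indexStep_of_mem P σ h] at this

theorem track_concat (k : Fin K) (l : List E) (e : E) :
    track P σ k (l ++ [e]) = indexStep P σ (G.tail e) (track P σ k l) := by
  simp [track]

/-- The walks are traced backwards. The change of index at a node is a bijection, so equal indices
after `tail e` were equal on arrival; the path with that index enters the node by only one edge, so
both walks arrived along the same edge. This repeats until the source, which no edge enters, where
the indices are the initial ones. -/
theorem eq_of_track_eq {k k' : Fin K} {Q Q' : G.Path} (hQ : Follows P σ k Q.edges)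
    (hQ' : Follows P σ k' Q'.edges) : ∀ (l l' m m' : List E) (e : E),
    Q.edges = l ++ e :: m → Q'.edges = l' ++ e :: m' →
    track P σ k (l ++ [e]) = track P σ k' (l' ++ [e]) → k = k' := by
  intro l
  induction l using List.reverseRecOn with
  | nil =>
    intro l' m m' e h h' ht
    have hs : G.tail e = G.s := by
      rw [← Q.starts]
      simp [h]
    rcases List.eq_nil_or_concat' l' with rfl | ⟨l', f, rfl⟩
    · simpa [track] using ht
    · have : G.head f = G.tail e := Q'.head_eq_tail (l := l') (m := m') (by simp [h'])
      exact absurd (this.trans hs) (head_ne_source f)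
  | append_singleton l f ih =>
    intro l' m m' e h h' ht
    have hf : G.head f = G.tail e := Q.head_eq_tail (l := l) (m := m) (by simp [h])
    rcases List.eq_nil_or_concat' l' with rfl | ⟨l', f', rfl⟩
    · have hs : G.tail e = G.s := by
        rw [← Q'.starts]
        simp [h']
      exact absurd (hf.trans hs) (head_ne_source f)
    · have hf' : G.head f' = G.tail e := Q'.head_eq_tail (l := l') (m := m') (by simp [h'])
      rw [track_concat P σ k (l ++ [f]), track_concat P σ k' (l' ++ [f'])] at ht
      have ht := (indexStep P σ _).injective ht
      rw [List.append_assoc] at h h'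
      have h1 := mem_edges_track P σ l (e :: m) k f (by simpa [h] using hQ)
      have h2 := mem_edges_track P σ l' (e :: m') k' f' (by simpa [h'] using hQ')
      rw [← ht] at h2
      obtain rfl := Path.eq_of_head_eq _ h1 h2 (hf.trans hf'.symm)
      exact ih l' (e :: m) (e :: m') f h h' ht

end Track

open Classical in
theorem IsRearrangementOf.card_le {K : ℕ} {P P' : Fin K → G.Path} (h : IsRearrangementOf P' P)
    (e : E) : (Finset.univ.filter fun k => e ∈ (P' k).edges).card ≤
      (Finset.univ.filter fun k => e ∈ (P k).edges).card := by
  obtain ⟨σ, hσ⟩ := h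
  have hsplit : ∀ k, ∃ l, e ∈ (P' k).edges → ∃ m, (P' k).edges = l ++ e :: m := by
    intro k
    by_cases he : e ∈ (P' k).edges
    · obtain ⟨l, m, hl⟩ := List.append_of_mem he
      exact ⟨l, fun _ => ⟨m, hl⟩⟩
    · exact ⟨[], fun h => absurd h he⟩
  choose l hl using hsplit
  refine Finset.card_le_card_of_injOn (fun k => track P σ k (l k ++ [e])) ?_ ?_
  · intro k hk
    simp only [Finset.coe_filter, Finset.mem_univ, true_and, Set.mem_ofPred_eq] at hk ⊢
    obtain ⟨m, hm⟩ := hl k hk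
    exact mem_edges_track P σ (l k) m k e (hm ▸ hσ k)
  · intro k hk k' hk' ht
    simp only [Finset.coe_filter, Finset.mem_univ, true_and, Set.mem_ofPred_eq] at hk hk'
    obtain ⟨m, hm⟩ := hl k hk
    obtain ⟨m', hm'⟩ := hl k' hk'
    exact eq_of_track_eq P σ (hσ k) (hσ k') _ _ _ _ e hm hm' ht

/-! ### Equal edge counts give a rearrangement -/

open Classical in
/-- The permutation at one node that links arriving and departing walkers. -/
theorem exists_perm_at_node {K : ℕ} {P P' : Fin K → G.Path} (b : E → Equiv.Perm (Fin K))
    (hb : ∀ e k, e ∈ (P' k).edges → e ∈ (P (b e k)).edges) (n : N) :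
    ∃ σ : Equiv.Perm (indicesAt P n), ∀ k, ∀ f ∈ (P' k).edges, G.tail f = n →
      (n = G.s → ∃ h : k ∈ indicesAt P n, (σ.symm ⟨k, h⟩ : Fin K) = b f k) ∧
      ∀ e ∈ (P' k).edges, G.head e = n →
        ∃ h : b e k ∈ indicesAt P n, (σ.symm ⟨b e k, h⟩ : Fin K) = b f k := by
  -- `I` indexes the walkers that leave `n`. Walker `i` arrives with index `inn i`, which is its own
  -- index at the source, and must leave with `b (o i) i`. Both maps are injective since a path of
  -- `P` has at most one edge into and one edge out of `n`; `σ` extends departure ↦ arrival because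
  -- walkers apply `σ⁻¹`.
  let I := {k // ∃ f ∈ (P' k).edges, G.tail f = n}
  choose o ho hon using fun i : I => i.2
  have hi : ∀ i : I, ∃ j : Fin K, j ∈ indicesAt P n ∧ (n = G.s → j = i) ∧
      ∀ e ∈ (P' i).edges, G.head e = n → j = b e i := by
    intro i
    by_cases hs : n = G.s
    · obtain ⟨e, he, hes⟩ := (P i).exists_tail_eq_source
      exact ⟨i, ⟨e, he, Or.inl (hes.trans hs.symm)⟩, fun _ => rfl,
        fun e _ he => absurd (he.trans hs) (head_ne_source e)⟩
    · obtain ⟨e, he, hen⟩ := (P' i).exists_head_eq (ho i) (by rwa [hon])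
      rw [hon] at hen
      refine ⟨b e i, ⟨e, hb e i he, Or.inr hen⟩, fun h => absurd h hs, fun e' he' hen' => ?_⟩
      rw [(P' i).eq_of_head_eq he' he (hen'.trans hen.symm)]
  choose inn hmem hsrc hinn using hi
  have hout : ∀ i : I, b (o i) i ∈ indicesAt P n := fun i => ⟨o i, hb _ _ (ho i), Or.inl (hon i)⟩
  obtain ⟨σ, hσ⟩ := exists_perm_comp_eq (fun i : I => (⟨b (o i) i, hout i⟩ : indicesAt P n))
    (fun i : I => (⟨inn i, hmem i⟩ : indicesAt P n))
    (by
      intro i j hij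
      have hij : b (o i) i = b (o j) j := congrArg Subtype.val hij
      have h1 := hb _ _ (ho i)
      rw [hij] at h1
      rw [Path.eq_of_tail_eq _ h1 (hb _ _ (ho j)) ((hon i).trans (hon j).symm)] at hij
      exact Subtype.ext ((b (o j)).injective hij))
    (by
      intro i j hij
      have hij : inn i = inn j := congrArg Subtype.val hij
      by_cases hs : n = G.s
      · rw [hsrc i hs, hsrc j hs] at hij
        exact Subtype.ext hij
      · obtain ⟨e, he, hen⟩ := (P' i).exists_head_eq (ho i) (by rwa [hon])
        obtain ⟨f, hf, hfn⟩ := (P' j).exists_head_eq (ho j) (by rwa [hon])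
        rw [hon] at hen hfn
        rw [hinn i e he hen, hinn j f hf hfn] at hij
        have h1 := hb _ _ he
        rw [hij] at h1
        rw [Path.eq_of_head_eq _ h1 (hb _ _ hf) (hen.trans hfn.symm)] at hij
        exact Subtype.ext ((b f).injective hij))
  refine ⟨σ, fun k f hf hfn => ?_⟩
  have hof : o ⟨k, f, hf, hfn⟩ = f :=
    (P' k).eq_of_tail_eq (ho ⟨k, f, hf, hfn⟩) hf ((hon _).trans hfn.symm)
  have key : ∀ j, inn ⟨k, f, hf, hfn⟩ = j →
      ∃ h : j ∈ indicesAt P n, (σ.symm ⟨j, h⟩ : Fin K) = b f k := by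
    rintro j rfl
    refine ⟨hmem _, ?_⟩
    have h1 := hσ ⟨k, f, hf, hfn⟩
    rw [← h1, Equiv.symm_apply_apply]
    simp only [hof]
  exact ⟨fun hs => key _ (hsrc _ hs), fun e he hen => key _ (hinn _ e he hen)⟩

open Classical in
theorem isRearrangementOf_of_card_eq {K : ℕ} {P P' : Fin K → G.Path}
    (h : ∀ e, (Finset.univ.filter fun k => e ∈ (P k).edges).card =
      (Finset.univ.filter fun k => e ∈ (P' k).edges).card) : IsRearrangementOf P' P := by
  have hb : ∀ e, ∃ b : Equiv.Perm (Fin K), ∀ k, e ∈ (P' k).edges → e ∈ (P (b k)).edges := by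
    intro e
    let q : {k // e ∈ (P' k).edges} ≃ {k // e ∈ (P k).edges} :=
      Fintype.equivOfCardEq (by rw [Fintype.card_subtype, Fintype.card_subtype, h e])
    exact ⟨q.extendSubtype, fun k hk => q.extendSubtype_mem k hk⟩
  choose b hb using hb
  choose σ hσ using exists_perm_at_node b hb
  refine ⟨σ, fun k => ?_⟩
  -- Invariant of the walk: once edge `e` has been taken, walker `k` carries `b e k`, the index of a
  -- path of `P` that uses `e`.
  have key : ∀ (l : List E) (e : E) (i : Fin K), (e :: l).IsChain
        (fun e e' => G.head e = G.tail e') → (∀ f ∈ e :: l, f ∈ (P' k).edges) →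
      (∃ h : i ∈ indicesAt P (G.tail e), ((σ (G.tail e)).symm ⟨i, h⟩ : Fin K) = b e k) →
      Follows P σ i (e :: l) := by
    intro l
    induction l with
    | nil =>
      rintro e i - hl ⟨h, hi⟩
      refine ⟨h, ?_, trivial⟩
      rw [hi]
      exact hb _ _ (hl e (by simp))
    | cons f l ih =>
      rintro e i hc hl ⟨h, hi⟩
      refine ⟨h, ?_, ?_⟩
      · rw [hi]
        exact hb _ _ (hl e (by simp))
      · rw [hi]
        rw [List.isChain_cons_cons] at hc
        exact ih f (b e k) hc.2 (fun g hg => hl g (List.mem_cons_of_mem _ hg))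
          ((hσ _ k f (hl f (by simp)) rfl).2 e (hl e (by simp)) hc.1)
  obtain ⟨e, l, hel⟩ := List.exists_cons_of_ne_nil (P' k).ne_nil
  have hs : G.tail e = G.s := by
    rw [← (P' k).starts]
    simp [hel]
  rw [hel]
  refine key l e k (hel ▸ (P' k).chain) (fun f hf => hel ▸ hf) ?_
  exact (hσ (G.tail e) k e (by simp [hel]) rfl).1 hs

open Classical in
/-- Sequences of paths are rearrangement equivalent if and only if they use every edge equally
often. -/
theorem rearrangementEquivalent_iff {K : ℕ} (P P' : Fin K → G.Path) :
    RearrangementEquivalent P P' ↔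
      ∀ e, (Finset.univ.filter fun k => e ∈ (P k).edges).card =
        (Finset.univ.filter fun k => e ∈ (P' k).edges).card :=
  ⟨fun h e => le_antisymm (h.2.card_le e) (h.1.card_le e), fun h =>
    ⟨isRearrangementOf_of_card_eq h, isRearrangementOf_of_card_eq fun e => (h e).symm⟩⟩

theorem linearIndependent_indicator_iff [Finite E] (S : Set G.Path) :
    LinearIndependent ℝ (fun P : S => (P : G.Path).indicator) ↔
      ¬ ∃ (K : ℕ) (P P' : Fin K → G.Path), (∀ k, P k ∈ S) ∧ (∀ k, P' k ∈ S) ∧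
        DistinctSequences P P' ∧ RearrangementEquivalent P P' := by
  classical
  cases nonempty_fintype E
  -- Every path has exactly one edge leaving the source.
  have := linearIndependent_zero_one_subtype_iff (fun (P : G.Path) e => e ∈ P.edges)
    (Finset.univ.filter fun e => G.tail e = G.s) (fun P => ?_) RearrangementEquivalent
    (fun {K} P P' => by convert rearrangementEquivalent_iff P P') S
  · convert this
    simp [Path.indicator]
  · obtain ⟨e, he, hes⟩ := P.exists_tail_eq_source
    rw [Finset.card_eq_one]
    refine ⟨e, Finset.ext fun f => ?_⟩
    simp only [Finset.mem_filter, Finset.mem_univ, true_and, Finset.mem_singleton]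
    constructor
    · rintro ⟨hf, hf'⟩
      exact P.eq_of_tail_eq hf' he (hf.trans hes.symm)
    · rintro rfl
      exact ⟨hes, he⟩

end SourceSinkDAG

/-! ### Preferences and choice functions -/

namespace Preference

variable {X : Type*} [Fintype X]

/-- The set of the `k` best alternatives. -/
def topSet (k : ℕ) (p : Preference X) : Set X := {x | (p.symm x : ℕ) < k}

theorem topSet_zero (p : Preference X) : topSet 0 p = ∅ := by simp [topSet]

theorem topSet_succ (p : Preference X) (k : Fin (Fintype.card X)) :
    topSet (k + 1) p = insert (p k) (topSet k p) := by
  ext x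
  simp only [topSet, Set.mem_ofPred_eq, Set.mem_insert_iff, Nat.lt_succ_iff_lt_or_eq,
    ← Equiv.symm_apply_eq, Fin.ext_iff]
  exact or_comm

/-- The set of the `k` best alternatives together with the next best one. -/
def rankEdge (k : Fin (Fintype.card X)) (p : Preference X) : Set X × X := (topSet k p, p k)

/-- The alternatives that are strictly better than `x`. -/
def better (p : Preference X) (x : X) : Finset X := (Finset.Iio (p.symm x)).map p.toEmbedding

theorem mem_better {p : Preference X} {x y : X} : y ∈ better p x ↔ p.symm y < p.symm x := by
  simp [better]

theorem notMem_better (p : Preference X) (x : X) : x ∉ better p x := by simp [mem_better]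

theorem card_better (p : Preference X) (x : X) : (better p x).card = p.symm x := by simp [better]

/-- The rank of `x` is the number of better alternatives, so a step of the chain is determined by
`x` and the set above it. -/
theorem rankEdge_eq_iff (k : Fin (Fintype.card X)) (p : Preference X) (B : Finset X) (x : X) :
    rankEdge k p = (↑B, x) ↔ better p x = B ∧ B.card = k := by
  have htop : (better p (p k) : Set X) = topSet k p := by
    ext y
    simp [mem_better, topSet]
  constructor
  · intro h
    obtain ⟨h1, rfl⟩ := Prod.mk.inj h
    rw [← htop] at h1
    rw [← Finset.coe_injective h1, card_better]
    simp
  · rintro ⟨rfl, h⟩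
    rw [card_better] at h
    obtain rfl : x = p k := by rw [← Fin.ext h, Equiv.apply_symm_apply]
    rw [htop, rankEdge]

theorem RearrangementEquivalent.exists_perm {K : ℕ} {p p' : Fin K → Preference X}
    (h : RearrangementEquivalent p p') (k : Fin (Fintype.card X)) :
    ∃ τ : Equiv.Perm (Fin K), ∀ n, rankEdge k (p' n) = rankEdge k (p (τ n)) := by
  obtain ⟨σ, hσ, hp⟩ := h
  refine ⟨(braid σ k).symm, fun n => Prod.ext ?_ (hp n k)⟩
  have key : ∀ j < Fintype.card X, topSet j (p' n) = topSet j (p ((braid σ j).symm n)) := by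
    intro j
    induction j with
    | zero => simp [topSet_zero]
    | succ j ih =>
      intro hj
      have hj' : j < Fintype.card X := Nat.lt_of_succ_lt hj
      have h1 := topSet_succ (p' n) ⟨j, hj'⟩
      rw [hp n] at h1
      simp only at h1
      rw [h1, ih hj']
      -- Passing from rank `j` to `j + 1` replaces the index by its preimage under `σ (j + 1)`,
      -- which preserves the set of `j + 1` best alternatives.
      have h2 : (braid σ j).symm n = σ (j + 1) ((braid σ (j + 1)).symm n) := by
        rw [Equiv.symm_apply_eq]
        exact ((braid σ (j + 1)).apply_symm_apply n).symm
      rw [← topSet_succ (p ((braid σ j).symm n)) ⟨j, hj'⟩, h2]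
      exact hσ (j + 1) hj _
  exact key k k.2

theorem rearrangementEquivalent_of_exists_perm {K : ℕ} {p p' : Fin K → Preference X}
    (h : ∀ k, ∃ τ : Equiv.Perm (Fin K), ∀ n, rankEdge k (p' n) = rankEdge k (p (τ n))) :
    RearrangementEquivalent p p' := by
  have h' : ∀ k : ℕ, ∃ τ : Equiv.Perm (Fin K), ∀ hk : k < Fintype.card X, ∀ n,
      rankEdge ⟨k, hk⟩ (p' n) = rankEdge ⟨k, hk⟩ (p (τ n)) := by
    intro k
    by_cases hk : k < Fintype.card X
    · obtain ⟨τ, hτ⟩ := h ⟨k, hk⟩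
      exact ⟨τ, fun _ => hτ⟩
    · exact ⟨1, fun h => absurd h hk⟩
  choose τ hτ using h'
  -- This choice makes the composition telescope to `(τ k)⁻¹`. At rank `k + 1` it exchanges `p (τ k
  -- m)` and `p (τ (k + 1) m)`, which are compatible because both share their `k + 1` best
  -- alternatives with `p' m`.
  let σ : ℕ → Equiv.Perm (Fin K) := fun k => Nat.casesOn k (τ 0)⁻¹ fun k => τ k * (τ (k + 1))⁻¹
  have hbraid : ∀ k, braid σ k = (τ k)⁻¹ := by
    intro k
    induction k with
    | zero => rfl
    | succ k ih =>
      rw [braid, ih]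
      exact inv_mul_cancel_left _ _
  refine ⟨σ, fun k hk n => ?_, fun n k => ?_⟩
  · change topSet k _ = topSet k _
    cases k with
    | zero => simp [topSet_zero]
    | succ k =>
      have hk' : k < Fintype.card X := Nat.lt_of_succ_lt hk
      obtain ⟨m, rfl⟩ := (τ (k + 1)).surjective n
      have h1 : σ (k + 1) (τ (k + 1) m) = τ k m := by simp [σ]
      have h2 := Prod.mk.inj (hτ k hk' m)
      have h3 := (Prod.mk.inj (hτ (k + 1) hk m)).1
      rw [h1]
      refine Eq.trans ?_ h3
      have h4 := topSet_succ (p (τ k m)) ⟨k, hk'⟩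
      have h5 := topSet_succ (p' m) ⟨k, hk'⟩
      rw [h2.1, h2.2] at h5
      exact h4.trans h5.symm
  · rw [hbraid]
    exact (Prod.mk.inj (hτ k k.2 n)).2

open Classical in
theorem rearrangementEquivalent_iff_rankEdge {K : ℕ} (p p' : Fin K → Preference X) :
    RearrangementEquivalent p p' ↔ ∀ k a, (Finset.univ.filter fun n => rankEdge k (p n) = a).card =
      (Finset.univ.filter fun n => rankEdge k (p' n) = a).card := by
  constructor
  · intro h k a
    obtain ⟨τ, hτ⟩ := h.exists_perm k
    symm
    refine Finset.card_equiv τ fun n => ?_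
    simp [hτ n]
  · intro h
    exact rearrangementEquivalent_of_exists_perm fun k => exists_perm_of_card_fiber_eq _ _ (h k)

open Classical in
theorem rearrangementEquivalent_iff_better {K : ℕ} (p p' : Fin K → Preference X) :
    RearrangementEquivalent p p' ↔ ∀ x B, (Finset.univ.filter fun n => better (p n) x = B).card =
      (Finset.univ.filter fun n => better (p' n) x = B).card := by
  rw [rearrangementEquivalent_iff_rankEdge]
  constructor
  · intro h x B
    by_cases hx : x ∈ B
    · have : ∀ q : Preference X, better q x ≠ B := by
        rintro q rfl
        exact notMem_better q x hx
      simp [this]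
    · have hB : B.card < Fintype.card X := Finset.card_lt_univ_of_notMem hx
      simpa [rankEdge_eq_iff] using h ⟨B.card, hB⟩ (↑B, x)
  · rintro h k ⟨T, x⟩
    have hT : T = ↑T.toFinset := by simp
    rw [hT]
    simp only [rankEdge_eq_iff]
    by_cases hk : T.toFinset.card = k
    · simpa only [hk, and_true] using h x T.toFinset
    · simp only [hk, and_false]

open Classical in
theorem card_better_subset {K : ℕ} (p : Fin K → Preference X) (x : X) (C : Finset X) :
    (Finset.univ.filter fun n => better (p n) x ⊆ C).card =
      ∑ B ∈ C.powerset, (Finset.univ.filter fun n => better (p n) x = B).card := by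
  rw [Finset.card_eq_sum_card_fiberwise (f := fun n => better (p n) x) (t := C.powerset)]
  · refine Finset.sum_congr rfl fun B hB => ?_
    rw [Finset.filter_filter]
    congr 1
    ext n
    simp only [Finset.mem_filter, Finset.mem_univ, true_and, and_iff_right_iff_imp]
    rintro rfl
    exact Finset.mem_powerset.1 hB
  · intro n hn
    simpa using hn

/-- The alternative `c.1` is the best one of the menu `c.2`. -/
def IsBest (p : Preference X) (c : X × Finset X) : Prop :=
  c.1 ∈ c.2 ∧ ∀ y ∈ c.2, p.symm c.1 ≤ p.symm y

-- Choice from `A` thus counts the sets `better p x` contained in `Aᶜ`, a cumulative sum over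
-- subsets.
open Classical in
theorem isBest_iff (p : Preference X) (x : X) (A : Finset X) :
    IsBest p (x, A) ↔ x ∈ A ∧ better p x ⊆ Aᶜ := by
  refine and_congr_right fun _ => ?_
  simp only [Finset.subset_iff, mem_better, Finset.mem_compl]
  exact forall_congr' fun y => by rw [← not_lt]; tauto

open Classical in
/-- Sequences of preferences are rearrangement equivalent if and only if their choice functions have
the same sum. -/
theorem rearrangementEquivalent_iff {K : ℕ} (p p' : Fin K → Preference X) :
    RearrangementEquivalent p p' ↔ ∀ c, (Finset.univ.filter fun n => IsBest (p n) c).card =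
      (Finset.univ.filter fun n => IsBest (p' n) c).card := by
  rw [rearrangementEquivalent_iff_better]
  constructor
  · rintro h ⟨x, A⟩
    simp only [isBest_iff]
    by_cases hx : x ∈ A
    · simp only [hx, true_and, card_better_subset, h x]
    · simp only [hx, false_and]
  · intro h x B
    -- Möbius inversion on subsets: the menu `Bᶜ` gives the sum of the counts over all `C ⊆ B`, and
    -- the terms with `C ≠ B` agree by induction.
    induction B using Finset.strongInduction with
    | H B ih =>
      by_cases hx : x ∈ B
      · have : ∀ q : Preference X, better q x ≠ B := by
          rintro q rfl
          exact notMem_better q x hx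
        simp [this]
      · have h1 := h (x, Bᶜ)
        simp only [isBest_iff, Finset.mem_compl, hx, not_false_eq_true, true_and, compl_compl,
          card_better_subset] at h1
        rw [← Finset.add_sum_erase _ _ (Finset.mem_powerset_self B),
          ← Finset.add_sum_erase _ _ (Finset.mem_powerset_self B)] at h1
        have h2 : ∀ C ∈ B.powerset.erase B,
            (Finset.univ.filter fun n => better (p n) x = C).card =
              (Finset.univ.filter fun n => better (p' n) x = C).card := by
          intro C hC
          rw [Finset.mem_erase, Finset.mem_powerset] at hC
          exact ih C (hC.2.ssubset_of_ne hC.1)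
        rw [Finset.sum_congr rfl h2] at h1
        exact Nat.add_right_cancel h1

theorem linearIndependent_choiceVector_iff [Nonempty X] (S : Set (Preference X)) :
    LinearIndependent ℝ (fun p : S => choiceVector (p : Preference X)) ↔
      ¬ ∃ (K : ℕ) (p p' : Fin K → Preference X), (∀ k, p k ∈ S) ∧ (∀ k, p' k ∈ S) ∧
        DistinctSequences p p' ∧ RearrangementEquivalent p p' := by
  classical
  -- On the full menu exactly one alternative is best; it exists because `X` is nonempty.
  have := linearIndependent_zero_one_subtype_iff (fun (p : Preference X) c => IsBest p c)
    (Finset.univ.filter fun c => c.2 = Finset.univ) (fun p => ?_) RearrangementEquivalent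
    (fun {K} p p' => by convert rearrangementEquivalent_iff p p') S
  · convert this
    exact if_congr Iff.rfl rfl rfl
  · rw [Finset.card_eq_one]
    let z : Fin (Fintype.card X) := ⟨0, Fintype.card_pos⟩
    have hz : ∀ y, z ≤ p.symm y := fun y => Nat.zero_le _
    refine ⟨(p z, Finset.univ), Finset.ext ?_⟩
    rintro ⟨x, A⟩
    simp only [Finset.mem_filter, Finset.mem_univ, true_and, Finset.mem_singleton, Prod.mk.injEq]
    constructor
    · rintro ⟨rfl, -, h⟩
      refine ⟨?_, rfl⟩
      have h1 := h (p z) (Finset.mem_univ _)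
      rw [Equiv.symm_apply_apply] at h1
      rw [← Equiv.symm_apply_eq]
      exact le_antisymm h1 (hz x)
    · rintro ⟨rfl, rfl⟩
      exact ⟨rfl, Finset.mem_univ _, fun y _ => by rw [Equiv.symm_apply_apply]; exact hz y⟩

end Preference

theorem mainTheorem8 {N E : Type*} [Finite N] [Finite E] (G : SourceSinkDAG N E) :
    (∀ S : Set G.Path,
      LinearIndependent ℝ (fun P : S => (P : G.Path).indicator) ↔
        ¬ ∃ (K : ℕ) (P P' : Fin K → G.Path), (∀ k, P k ∈ S) ∧ (∀ k, P' k ∈ S) ∧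
          DistinctSequences P P' ∧ SourceSinkDAG.RearrangementEquivalent P P') ∧
    (∀ (X : Type*) [Fintype X] [Nonempty X] (S : Set (Preference X)),
      LinearIndependent ℝ (fun p : S => Preference.choiceVector (p : Preference X)) ↔
        ¬ ∃ (K : ℕ) (p p' : Fin K → Preference X), (∀ k, p k ∈ S) ∧ (∀ k, p' k ∈ S) ∧
          DistinctSequences p p' ∧ Preference.RearrangementEquivalent p p') := by
  exact ⟨SourceSinkDAG.linearIndependent_indicator_iff,
    fun _ _ _ S => Preference.linearIndependent_choiceVector_iff S⟩
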